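/- **Setting.** Let $-\infty\le a<b\le\infty$, let $V\in L^1_{\mathrm{loc}}(a,b)$ be real-valued, let $I\subseteq\mathbb Z$, and let $M=\{x_n\}_{n\in I}\subset(a,b)$ be a set of pairwise distinct points that accumulates at most at $a$ or $b$. For $\Lambda=(\alpha_n)\in\mathbb R^I$, $R=(r_n)\in(0,\infty)^I$ and $\Theta=(\theta_n)\in\mathbb R^I$ put $$A_{\alpha_n,r_n,\theta_n}=\begin{pmatrix}1&\alpha_n\\0&1\end{pmatrix}\begin{pmatrix}r_n&0\\0&1/r_n\end{pmatrix}\begin{pmatrix}\cos\theta_n&-\sin\theta_n\\ \sin\theta_n&\cos\theta_n\end{pmatrix},\qquad \tau f=-f''+Vf .$$ For $z\in\mathbb C$, a solution of $(\tau_{\Lambda,R,\Theta}-z)f=0$ is a function $f$ such that $f,f'$ are locally absolutely continuous in $(a,b)\setminus M$, $-f''+Vf-zf=0$ a.e., and $$\begin{pmatrix}f(x_n+)\\f'(x_n+)\end{pmatrix}=A_{\alpha_n,r_n,\theta_n}\begin{pmatrix}f(x_n-)\\f'(x_n-)\end{pmatrix}\quad\text{for all }n\in I.\qquad(*)$$ We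 say that $\tau_{\Lambda,R,\Theta}$ is in the limit point case at $a$ if for every $z\in\mathbb C$ some solution of $(\tau_{\Lambda,R,\Theta}-z)f=0$ is not square integrable near $a$, and that it is regular at $a$ if $a$ is finite, $V\in L^1_{\mathrm{loc}}[a,b)$ and $a$ is not an accumulation point of $M$; similarly at $b$. Assume that, for all $(\Lambda,R,\Theta)$, $\tau_{\Lambda,R,\Theta}$ is at each of the two endpoints either in the limit point case or regular. Fix $\psi_a,\psi_b\in[0,\pi)$. Let $H_{\Lambda,R,\Theta}$ be the self-adjoint operator $H_{\Lambda,R,\Theta}f=\tau f$ in $L^2(a,b)$ whose domain consists of all $f\in L^2(a,b)$ such that $f,f'$ are locally absolutely continuous in $(a,b)\setminus M$, $\tau f\in L^2(a,b)$, $(*)$ holds, $f(a)\cos\psi_a+f'(a)\sin\psi_a=0$ if $a$ is a regular endpoint, and $f(b)\cos\psi_b+f'(b)\sin\psi_b=0$ if $b$ is a regular endpoint. Let $\sigma_p$ denote the set of eigenvalues. **Theorem.** Let $(p_n)_{n\in I}$ and $(q_n)_{n\in I}$ be families of Borel probability measures on $\mathbb R$ and $(\rho_n)_{n\in I}$ a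 family of Borel probability measures on $(0,\infty)$. Let $\mathbb P_1=\times_{n\in I}p_n$ on $\mathbb R^I$, $\mathbb P_2=\times_{n\in I}\rho_n$ on $(0,\infty)^I$, $\mathbb P_3=\times_{n\in I}q_n$ on $\mathbb R^I$ be the product measures, and $\mathbb P=\mathbb P_1\times\mathbb P_2\times\mathbb P_3$. Assume that for some $n_0\in I$ the measure $q_{n_0}$ is continuous, that is, $q_{n_0}(\{t\})=0$ for all $t\in\mathbb R$. Let $E\in\mathbb R$ be fixed, and suppose that $$P(E)=\{(\Lambda,R,\Theta)\in\mathbb R^I\times(0,\infty)^I\times\mathbb R^I:\ E\in\sigma_p(H_{\Lambda,R,\Theta})\}$$ is measurable with respect to the product $\sigma$-algebra or, more generally, its completion under $\mathbb P$. Then $$\mathbb P(P(E))=0 .$$ -/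

import Mathlib

open MeasureTheory Set Filter Topology

namespace PointInteraction

noncomputable section

/-- The real points of the open interval `(a, b)`, where `-∞ ≤ a < b ≤ ∞`. -/
def openInterval (a b : EReal) : Set ℝ := {t : ℝ | a < (t : EReal) ∧ (t : EReal) < b}

/-- The real `2 × 2` matrix `A_{α,r,θ} = P_α H_r E_θ` (Iwasawa decomposition):
a parabolic, a hyperbolic and an elliptic factor. -/
def interactionMatrix (α r θ : ℝ) : Matrix (Fin 2) (Fin 2) ℝ :=
  !![1, α; 0, 1] * !![r, 0; 0, 1 / r] * !![Real.cos θ, -Real.sin θ; Real.sin θ, Real.cos θ]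

/-- `f` is absolutely continuous on every compact interval contained in `U`. -/
def LocallyAC (f : ℝ → ℂ) (U : Set ℝ) : Prop :=
  ∀ c d : ℝ, c ≤ d → Icc c d ⊆ U → AbsolutelyContinuousOnInterval f c d

/-- `f` and `f'` are (locally) absolutely continuous on the open set `U`. -/
def HasACDerivative (f : ℝ → ℂ) (U : Set ℝ) : Prop :=
  LocallyAC f U ∧ DifferentiableOn ℝ f U ∧ LocallyAC (deriv f) U

/-- The differential expression `τ f = -f'' + V f`. -/
def tau (V : ℝ → ℝ) (f : ℝ → ℂ) : ℝ → ℂ :=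
  fun t => -deriv (deriv f) t + (V t : ℂ) * f t

/-- `(f, f')` has the limit `(p, p')` along the filter `l`. -/
def HasLimitData (f : ℝ → ℂ) (l : Filter ℝ) (p p' : ℂ) : Prop :=
  Tendsto f l (𝓝 p) ∧ Tendsto (deriv f) l (𝓝 p')

/-- The interaction condition at the point `y` with matrix `A`: the one-sided limits exist and
`(f(y+), f'(y+))ᵀ = A (f(y-), f'(y-))ᵀ`. -/
def JumpCondition (A : Matrix (Fin 2) (Fin 2) ℝ) (y : ℝ) (f : ℝ → ℂ) : Prop :=
  ∃ p p' q q' : ℂ, HasLimitData f (𝓝[<] y) p p' ∧ HasLimitData f (𝓝[>] y) q q' ∧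
    ![q, q'] = (A.map Complex.ofReal).mulVec ![p, p']

section Operator

variable {I : Set ℤ} (a b : EReal) (V : ℝ → ℝ) (x : I → ℝ)
  (Λ : I → ℝ) (R : I → Ioi (0 : ℝ)) (Θ : I → ℝ)

/-- `f` satisfies the interaction condition with matrix `A_{α_n,r_n,θ_n}` at `x_n`, for all `n`. -/
def JumpConditions (f : ℝ → ℂ) : Prop :=
  ∀ n : I, JumpCondition (interactionMatrix (Λ n) (R n) (Θ n)) (x n) f

/-- `f` is a solution of `(τ_{Λ,R,Θ} - z) f = 0` on `(a, b)`. -/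
def IsSolution (z : ℂ) (f : ℝ → ℂ) : Prop :=
  HasACDerivative f (openInterval a b \ range x) ∧
  (∀ᵐ t ∂volume.restrict (openInterval a b), tau V f t - z * f t = 0) ∧
  JumpConditions x Λ R Θ f

/-- `f` is square integrable near the left endpoint `a`. -/
def LiesLeft (f : ℝ → ℂ) : Prop :=
  ∃ c ∈ openInterval a b, MemLp f 2 (volume.restrict (openInterval a c))

/-- `f` is square integrable near the right endpoint `b`. -/
def LiesRight (f : ℝ → ℂ) : Prop :=
  ∃ c ∈ openInterval a b, MemLp f 2 (volume.restrict (openInterval c b))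

/-- `τ_{Λ,R,Θ}` is in the limit point case at `a`. -/
def LimitPointLeft : Prop :=
  ∀ z : ℂ, ∃ f : ℝ → ℂ, IsSolution a b V x Λ R Θ z f ∧ ¬ LiesLeft a b f

/-- `τ_{Λ,R,Θ}` is in the limit point case at `b`. -/
def LimitPointRight : Prop :=
  ∀ z : ℂ, ∃ f : ℝ → ℂ, IsSolution a b V x Λ R Θ z f ∧ ¬ LiesRight a b f

/-- `τ_{Λ,R,Θ}` is regular at `a`, the real number `a₀` being the value of `a`: `V` is locally
integrable on `[a, b)`, and the points `x_n` do not accumulate at `a`.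
This does not depend on `Λ`, `R`, `Θ`. -/
def RegularLeft (a₀ : ℝ) : Prop :=
  a = (a₀ : EReal) ∧
  LocallyIntegrableOn V {t : ℝ | a ≤ (t : EReal) ∧ (t : EReal) < b} ∧
  ∃ c : ℝ, a₀ < c ∧ ∀ n : I, c ≤ x n

/-- `τ_{Λ,R,Θ}` is regular at `b`, the real number `b₀` being the value of `b`. -/
def RegularRight (b₀ : ℝ) : Prop :=
  b = (b₀ : EReal) ∧
  LocallyIntegrableOn V {t : ℝ | a < (t : EReal) ∧ (t : EReal) ≤ b} ∧
  ∃ c : ℝ, c < b₀ ∧ ∀ n : I, x n ≤ c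

/-- The domain of the maximal operator `T_{Λ,R,Θ}` in `L²(a, b)`. -/
def MemMaximalDomain (f : ℝ → ℂ) : Prop :=
  MemLp f 2 (volume.restrict (openInterval a b)) ∧
  HasACDerivative f (openInterval a b \ range x) ∧
  MemLp (tau V f) 2 (volume.restrict (openInterval a b)) ∧
  JumpConditions x Λ R Θ f

/-- The separated boundary condition `f cos ψ + f' sin ψ = 0`, for the limits of `f` and `f'`
along `l`. -/
def BoundaryCondition (ψ : ℝ) (l : Filter ℝ) (f : ℝ → ℂ) : Prop :=
  ∃ p p' : ℂ, HasLimitData f l p p' ∧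
    p * (Real.cos ψ : ℂ) + p' * (Real.sin ψ : ℂ) = 0

variable (ψa ψb : ℝ)

/-- The domain of the operator `H_{Λ,R,Θ}`, which acts as `τ`: the functions in the domain of
`T_{Λ,R,Θ}` that satisfy the separated boundary condition with angle `ψa` (`ψb`) at `a` (`b`) if
`τ_{Λ,R,Θ}` is regular there. No condition is imposed at an endpoint in the limit point case.
This is the self-adjoint operator whenever each endpoint is regular or in the limit
point case. -/
def MemDomain (f : ℝ → ℂ) : Prop :=
  MemMaximalDomain a b V x Λ R Θ f ∧
  (∀ a₀ : ℝ, RegularLeft a b V x a₀ → BoundaryCondition ψa (𝓝[>] a₀) f) ∧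
  (∀ b₀ : ℝ, RegularRight a b V x b₀ → BoundaryCondition ψb (𝓝[<] b₀) f)

/-- `E ∈ σ_p(H_{Λ,R,Θ})`: there is `f` in the domain of `H_{Λ,R,Θ}`, nonzero as an element of
`L²(a, b)`, with `H_{Λ,R,Θ} f = E f` in `L²(a, b)`. -/
def IsEigenvalue (E : ℝ) : Prop :=
  ∃ f : ℝ → ℂ, MemDomain a b V x Λ R Θ ψa ψb f ∧
    ¬ (f =ᵐ[volume.restrict (openInterval a b)] 0) ∧
    tau V f =ᵐ[volume.restrict (openInterval a b)] fun t => (E : ℂ) * f t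

/-- The set `P(E)` of all parameters `(Λ, R, Θ)` with `E ∈ σ_p(H_{Λ,R,Θ})`. -/
def eigenvalueSet (E : ℝ) : Set ((I → ℝ) × (I → Ioi (0 : ℝ)) × (I → ℝ)) :=
  {ω | IsEigenvalue a b V x ω.1 ω.2.1 ω.2.2 ψa ψb E}

end Operator

/-- The law `ℙ = ℙ₁ × ℙ₂ × ℙ₃` of the random parameters `(Λ, R, Θ)`, where
`ℙ₁ = ×ₙ pₙ`, `ℙ₂ = ×ₙ ρₙ` and `ℙ₃ = ×ₙ qₙ` are product measures. -/
def parameterLaw {I : Set ℤ} (p : I → Measure ℝ) (ρ : I → Measure (Ioi (0 : ℝ)))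
    (q : I → Measure ℝ) : Measure ((I → ℝ) × (I → Ioi (0 : ℝ)) × (I → ℝ)) :=
  (Measure.infinitePi p).prod ((Measure.infinitePi ρ).prod (Measure.infinitePi q))

end

end PointInteraction

/-! Freeze every parameter except the angle at `x n₀`. Since `q n₀` has no atoms, Fubini reduces the
claim to this: the angles for which `E` is an eigenvalue form a countable set.

Let `f` and `g` be eigenfunctions for two angles `θ` and `θ'`. On either side of `x n₀` both solve
the same problem, and the limit point property or the boundary condition at the end leaves at most
one solution up to a factor. Hence their Wronskian vanishes on both sides
(`IsBoundSolution.wronskian_left`, `IsBoundSolution.wronskian_right`): the two interaction matrices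
send one line of data to one and the same line. The parabolic and hyperbolic factors are common and
cancel, so the rotation by `θ' - θ` preserves that line. The line is real, because the conjugate of
`f` is a bound state too; hence `θ' - θ` is a multiple of `π` (`sin_sub_eq_zero_of_wronskian`).

Two facts about the equation are needed. The Wronskian is constant, even across interactions,
because the matrices have determinant one; and a solution with vanishing data at one point vanishes,
by Gronwall, so the lines above are genuine. Both are checked on the two sides of each point and
made global by connectedness (`IsPreconnected.exists_forall_eventually_eq`). -/

namespace PointInteraction

/-! ### Absolutely continuous functions -/

theorem _root_.AbsolutelyContinuousOnInterval.lipschitzOnWith_comp {X Y : Type*}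
    [PseudoMetricSpace X] [PseudoMetricSpace Y] {φ : X → Y} {f : ℝ → X} {c d : ℝ} {K : NNReal}
    {s : Set X} (hφ : LipschitzOnWith K φ s) (hs : ∀ t ∈ uIcc c d, f t ∈ s)
    (hf : AbsolutelyContinuousOnInterval f c d) :
    AbsolutelyContinuousOnInterval (fun t => φ (f t)) c d := by
  refine squeeze_zero' (g := fun E : ℕ × (ℕ → ℝ × ℝ) =>
      (K : ℝ) * ∑ i ∈ Finset.range E.1, dist (f (E.2 i).1) (f (E.2 i).2)) ?_ ?_ ?_
  · exact Eventually.of_forall fun _ => Finset.sum_nonneg fun _ _ => dist_nonneg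
  · rw [eventually_inf_principal]
    refine Eventually.of_forall fun D hD => ?_
    rw [Finset.mul_sum]
    exact Finset.sum_le_sum fun i hi =>
      hφ.dist_le_mul _ (hs _ (hD.1 i hi).1) _ (hs _ (hD.1 i hi).2)
  · simpa using Tendsto.const_mul (K : ℝ) hf

theorem _root_.AbsolutelyContinuousOnInterval.lipschitzWith_comp {X Y : Type*}
    [PseudoMetricSpace X] [PseudoMetricSpace Y] {φ : X → Y} {f : ℝ → X} {c d : ℝ} {K : NNReal}
    (hφ : LipschitzWith K φ) (hf : AbsolutelyContinuousOnInterval f c d) :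
    AbsolutelyContinuousOnInterval (fun t => φ (f t)) c d :=
  hf.lipschitzOnWith_comp (hφ.lipschitzOnWith (s := univ)) fun _ _ => mem_univ _

/-- The exponential is only locally Lipschitz, which suffices because an absolutely continuous
function is bounded. -/
theorem _root_.AbsolutelyContinuousOnInterval.exp {f : ℝ → ℝ} {c d : ℝ}
    (hf : AbsolutelyContinuousOnInterval f c d) :
    AbsolutelyContinuousOnInterval (fun t => Real.exp (f t)) c d := by
  obtain ⟨C, hC⟩ := hf.exists_bound
  obtain ⟨K, hK⟩ := (Real.contDiff_exp.contDiffOn (s := Icc (-C) C) (n := 1)).exists_lipschitzOnWith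
    (by decide) (convex_Icc _ _) isCompact_Icc
  exact hf.lipschitzOnWith_comp hK fun t ht => abs_le.1 (hC t ht)

theorem _root_.AbsolutelyContinuousOnInterval.norm_sq {F : Type*} [NormedAddCommGroup F]
    {f : ℝ → F} {c d : ℝ} (hf : AbsolutelyContinuousOnInterval f c d) :
    AbsolutelyContinuousOnInterval (fun t => ‖f t‖ ^ 2) c d := by
  have h : AbsolutelyContinuousOnInterval (fun t => ‖f t‖) c d :=
    hf.lipschitzWith_comp lipschitzWith_one_norm
  simpa only [sq] using h.fun_mul h

/-- The fundamental theorem of calculus replaces the mean value theorem: with `V` merely integrable,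
the derivatives below exist only almost everywhere. -/
theorem _root_.AbsolutelyContinuousOnInterval.le_of_ae_deriv_nonneg {f f' : ℝ → ℝ} {c d : ℝ}
    (hcd : c ≤ d) (hf : AbsolutelyContinuousOnInterval f c d)
    (hf' : ∀ᵐ t, t ∈ Ioo c d → HasDerivAt f (f' t) t) (h : ∀ t ∈ Ioo c d, 0 ≤ f' t) :
    f c ≤ f d := by
  rw [← sub_nonneg, ← hf.integral_deriv_eq_sub]
  refine intervalIntegral.integral_nonneg_of_ae_restrict hcd ?_
  rw [Filter.EventuallyLE, ← restrict_Ioo_eq_restrict_Icc, ae_restrict_iff' measurableSet_Ioo]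
  filter_upwards [hf'] with t ht hmem
  rw [(ht hmem).deriv]
  exact h t hmem

/-! ### Solutions on open sets without interaction points -/

/-- `f` solves `τ f = E f` on `U`, without interactions. -/
def SolvesOn (V : ℝ → ℝ) (E : ℝ) (U : Set ℝ) (f : ℝ → ℂ) : Prop :=
  HasACDerivative f U ∧ ∀ᵐ t ∂volume.restrict U, tau V f t = (E : ℂ) * f t

/-- The Wronskian. -/
noncomputable def wronskian (f g : ℝ → ℂ) (t : ℝ) : ℂ := f t * deriv g t - deriv f t * g t

theorem LocallyAC.mono {f : ℝ → ℂ} {U W : Set ℝ} (hf : LocallyAC f U) (h : W ⊆ U) :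
    LocallyAC f W :=
  fun c d hcd hs => hf c d hcd (hs.trans h)

theorem LocallyAC.star {f : ℝ → ℂ} {U : Set ℝ} (hf : LocallyAC f U) :
    LocallyAC (fun t => star (f t)) U :=
  fun c d hcd hs => (hf c d hcd hs).lipschitzWith_comp (starₗᵢ ℂ (E := ℂ)).lipschitz

theorem LocallyAC.ae_differentiableAt {f : ℝ → ℂ} {l r : ℝ}
    (hf : LocallyAC f (Ioo l r)) {c d : ℝ} (hcd : c ≤ d) (hs : Icc c d ⊆ Ioo l r) :
    ∀ᵐ t, t ∈ Icc c d → DifferentiableAt ℝ f t := by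
  have := (hf c d hcd hs).boundedVariationOn.ae_differentiableAt_of_mem_uIcc
  rwa [uIcc_of_le hcd] at this

theorem HasACDerivative.mono {f : ℝ → ℂ} {U W : Set ℝ} (hf : HasACDerivative f U) (h : W ⊆ U) :
    HasACDerivative f W :=
  ⟨hf.1.mono h, hf.2.1.mono h, hf.2.2.mono h⟩

theorem HasACDerivative.star {f : ℝ → ℂ} {U : Set ℝ} (hf : HasACDerivative f U) :
    HasACDerivative (fun t => star (f t)) U :=
  ⟨hf.1.star, hf.2.1.star, by rw [deriv.star']; exact hf.2.2.star⟩

theorem SolvesOn.mono {V : ℝ → ℝ} {E : ℝ} {U W : Set ℝ} {f : ℝ → ℂ} (hf : SolvesOn V E U f)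
    (h : W ⊆ U) : SolvesOn V E W f :=
  ⟨hf.1.mono h, ae_restrict_of_ae_restrict_of_subset h hf.2⟩

theorem tau_star (V : ℝ → ℝ) (f : ℝ → ℂ) (t : ℝ) :
    tau V (fun t => star (f t)) t = star (tau V f t) := by
  have h : deriv (deriv fun t => star (f t)) t = star (deriv (deriv f) t) := by
    rw [deriv.star', deriv.star]
  unfold tau
  rw [h]
  simp

/-- The second derivative of a solution. -/
theorem SolvesOn.ae_hasDerivAt_deriv {V : ℝ → ℝ} {E : ℝ} {l r : ℝ} {f : ℝ → ℂ}
    (hf : SolvesOn V E (Ioo l r) f) {c d : ℝ} (hcd : c ≤ d) (hs : Icc c d ⊆ Ioo l r) :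
    ∀ᵐ t, t ∈ Icc c d → HasDerivAt f (deriv f t) t ∧
      HasDerivAt (deriv f) (((V t - E : ℝ) : ℂ) * f t) t := by
  have h := (ae_restrict_iff' measurableSet_Ioo).1 hf.2
  filter_upwards [hf.1.2.2.ae_differentiableAt hcd hs, h] with t ht htau hmem
  refine ⟨((hf.1.2.1 t (hs hmem)).differentiableAt (Ioo_mem_nhds (hs hmem).1 (hs hmem).2)).hasDerivAt,
    ?_⟩
  have := htau (hs hmem)
  rw [tau] at this
  refine (ht hmem).hasDerivAt.congr_deriv ?_
  push_cast
  linear_combination -this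

/-- The Wronskian is absolutely continuous, and its derivative `f g'' - f'' g` is zero a.e., as both
second derivatives carry the same factor `V - E`. -/
theorem SolvesOn.wronskian_eq {V : ℝ → ℝ} {E : ℝ} {l r : ℝ} {f g : ℝ → ℂ}
    (hf : SolvesOn V E (Ioo l r) f) (hg : SolvesOn V E (Ioo l r) g) {s t : ℝ}
    (hs : s ∈ Ioo l r) (ht : t ∈ Ioo l r) : wronskian f g s = wronskian f g t := by
  wlog hst : s ≤ t generalizing s t
  · exact (this ht hs (le_of_not_ge hst)).symm
  have hsub : Icc s t ⊆ Ioo l r := fun u hu => ⟨hs.1.trans_le hu.1, hu.2.trans_lt ht.2⟩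
  have hAC : AbsolutelyContinuousOnInterval (wronskian f g) s t := by
    have h1 := (hf.1.1 s t hst hsub).fun_smul (hg.1.2.2 s t hst hsub)
    have h2 := (hf.1.2.2 s t hst hsub).fun_smul (hg.1.1 s t hst hsub)
    exact h1.fun_sub h2
  obtain ⟨C, hC⟩ := hAC.const_of_ae_hasDerivAt_zero (by
    rw [uIcc_of_le hst]
    filter_upwards [hf.ae_hasDerivAt_deriv hst hsub, hg.ae_hasDerivAt_deriv hst hsub]
      with u hfu hgu hu
    obtain ⟨hf1, hf2⟩ := hfu hu
    obtain ⟨hg1, hg2⟩ := hgu hu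
    refine HasDerivAt.congr_deriv (f := wronskian f g) ((hf1.mul hg2).sub (hf2.mul hg1)) ?_
    ring)
  rw [hC s left_mem_uIcc, hC t right_mem_uIcc]

/-- The squared norm of the data `(f, f')`. -/
noncomputable def energy (f : ℝ → ℂ) (t : ℝ) : ℝ := ‖f t‖ ^ 2 + ‖deriv f t‖ ^ 2

theorem energy_nonneg (f : ℝ → ℂ) (t : ℝ) : 0 ≤ energy f t := by
  unfold energy; positivity

theorem energy_eq_zero {f : ℝ → ℂ} {t : ℝ} : energy f t = 0 ↔ f t = 0 ∧ deriv f t = 0 := by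
  rw [energy, add_eq_zero_iff_of_nonneg (by positivity) (by positivity)]
  simp

/-- With `q = f'` and `v = V - E` the left side is the absolute value of the derivative of `energy
f`; this is the differential inequality for Gronwall. -/
theorem abs_energy_deriv_le (p q : ℂ) (v : ℝ) :
    |2 * inner ℝ p q + 2 * inner ℝ q ((v : ℂ) * p)| ≤ (1 + |v|) * (‖p‖ ^ 2 + ‖q‖ ^ 2) := by
  have h1 := abs_real_inner_le_norm p q
  have h2 := abs_real_inner_le_norm q ((v : ℂ) * p)
  rw [norm_mul, Complex.norm_real, Real.norm_eq_abs] at h2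
  have h3 : 2 * (‖p‖ * ‖q‖) ≤ ‖p‖ ^ 2 + ‖q‖ ^ 2 := by nlinarith [sq_nonneg (‖p‖ - ‖q‖)]
  have h4 := mul_le_mul_of_nonneg_left h3 (abs_nonneg v)
  calc _ ≤ |2 * inner ℝ p q| + |2 * inner ℝ q ((v : ℂ) * p)| := abs_add_le _ _
    _ = 2 * |inner ℝ p q| + 2 * |inner ℝ q ((v : ℂ) * p)| := by simp [abs_mul]
    _ ≤ _ := by linarith

/-- Gronwall in both directions, with rate `1 + |V - E|`. Its integral over the whole interval is
finite, so one constant serves all pairs of points, arbitrarily close to the ends. -/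
theorem SolvesOn.exists_energy_le {V : ℝ → ℝ} {E : ℝ} {l r : ℝ} {f : ℝ → ℂ}
    (hf : SolvesOn V E (Ioo l r) f) (hV : IntegrableOn V (Ioo l r)) :
    ∃ C, ∀ s ∈ Ioo l r, ∀ t ∈ Ioo l r, energy f s ≤ C * energy f t := by
  set k : ℝ → ℝ := fun t => 1 + |V t - E| with hk
  have hk0 : ∀ t, 0 ≤ k t := fun t => by positivity
  have hkint : IntegrableOn k (Ioo l r) :=
    (integrableOn_const (by simp)).add (hV.sub (integrableOn_const (by simp))).abs
  set B := ∫ t in Ioo l r, k t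
  have key : ∀ c ∈ Ioo l r, ∀ d ∈ Ioo l r, c ≤ d →
      energy f d ≤ Real.exp B * energy f c ∧ energy f c ≤ Real.exp B * energy f d := by
    intro c hc d hd hcd
    have hsub : Icc c d ⊆ Ioo l r := fun u hu => ⟨hc.1.trans_le hu.1, hu.2.trans_lt hd.2⟩
    have hki : IntervalIntegrable k volume c d :=
      (intervalIntegrable_iff_integrableOn_Icc_of_le hcd).2 (hkint.mono_set hsub)
    set K : ℝ → ℝ := fun t => ∫ u in c..t, k u
    have hKAC : AbsolutelyContinuousOnInterval K c d :=
      hki.absolutelyContinuousOnInterval_intervalIntegral left_mem_uIcc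
    have hKc : K c = 0 := intervalIntegral.integral_same
    have hKd : K d ≤ B := by
      simp only [K]
      rw [intervalIntegral.integral_of_le hcd]
      exact setIntegral_mono_set hkint (Eventually.of_forall hk0)
        (Ioc_subset_Icc_self.trans hsub).eventuallyLE
    have hFAC : AbsolutelyContinuousOnInterval (energy f) c d :=
      (hf.1.1 c d hcd hsub).norm_sq.fun_add (hf.1.2.2 c d hcd hsub).norm_sq
    have hderiv : ∀ᵐ t, t ∈ Ioo c d → HasDerivAt K (k t) t ∧ HasDerivAt (energy f)
        (2 * inner ℝ (f t) (deriv f t) +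
          2 * inner ℝ (deriv f t) (((V t - E : ℝ) : ℂ) * f t)) t := by
      filter_upwards [hki.ae_hasDerivAt_integral, hf.ae_hasDerivAt_deriv hcd hsub] with t h1 h2 ht
      have ht' := Ioo_subset_Icc_self ht
      exact ⟨h1 (by rwa [uIcc_of_le hcd]) c left_mem_uIcc,
        (h2 ht').1.norm_sq.add (h2 ht').2.norm_sq⟩
    have hbd := fun t => abs_le.1 (abs_energy_deriv_le (f t) (deriv f t) (V t - E))
    constructor
    -- Forward bound: `energy f * exp (-K)` is nonincreasing.
    · have h := AbsolutelyContinuousOnInterval.le_of_ae_deriv_nonneg hcd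
        (hFAC.fun_mul hKAC.neg.exp).fun_neg
        (by
          filter_upwards [hderiv] with t ht hmem
          exact ((ht hmem).2.mul (ht hmem).1.neg.exp).neg)
        (by
          intro t _
          have := mul_le_mul_of_nonneg_right (hbd t).2 (Real.exp_nonneg ((-K) t))
          simp only [energy, hk] at this ⊢
          linarith)
      simp only [Pi.neg_apply, hKc, neg_zero, Real.exp_zero, mul_one, neg_le_neg_iff] at h
      have h2 := mul_le_mul_of_nonneg_right h (Real.exp_nonneg (K d))
      rw [mul_assoc, ← Real.exp_add, neg_add_cancel, Real.exp_zero, mul_one] at h2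
      rw [mul_comm]
      exact h2.trans (mul_le_mul_of_nonneg_left (Real.exp_le_exp.2 hKd) (energy_nonneg f c))
    -- Backward bound: `energy f * exp K` is nondecreasing.
    · have h := AbsolutelyContinuousOnInterval.le_of_ae_deriv_nonneg hcd
        (hFAC.fun_mul hKAC.exp)
        (by
          filter_upwards [hderiv] with t ht hmem
          exact (ht hmem).2.mul (ht hmem).1.exp)
        (by
          intro t _
          have := mul_le_mul_of_nonneg_right (hbd t).1 (Real.exp_nonneg (K t))
          simp only [energy, hk] at this ⊢
          linarith)
      simp only [hKc, Real.exp_zero, mul_one] at h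
      rw [mul_comm]
      exact h.trans (mul_le_mul_of_nonneg_left (Real.exp_le_exp.2 hKd) (energy_nonneg f d))
  refine ⟨Real.exp B, fun s hs t ht => ?_⟩
  rcases le_total s t with h | h
  · exact (key s hs t ht h).2
  · exact (key t ht s hs h).1

/-! ### Limits at the ends of an interval -/

theorem SolvesOn.wronskian_eq_of_tendsto {V : ℝ → ℝ} {E : ℝ} {l r : ℝ} {f g : ℝ → ℂ}
    (hf : SolvesOn V E (Ioo l r) f) (hg : SolvesOn V E (Ioo l r) g) {F : Filter ℝ} [F.NeBot]
    (hF : Ioo l r ∈ F) {p p' q q' : ℂ} (hp : HasLimitData f F p p') (hq : HasLimitData g F q q')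
    {t : ℝ} (ht : t ∈ Ioo l r) : wronskian f g t = p * q' - p' * q := by
  have h1 : Tendsto (wronskian f g) F (𝓝 (p * q' - p' * q)) :=
    (hp.1.mul hq.2).sub (hp.2.mul hq.1)
  have h2 : Tendsto (wronskian f g) F (𝓝 (wronskian f g t)) :=
    tendsto_const_nhds.congr' (by
      filter_upwards [hF] with s hs using hf.wronskian_eq hg ht hs)
  exact tendsto_nhds_unique h2 h1

/-- The energy bound is uniform, so its reference point may move along `F`, where the energy tends
to zero. -/
theorem SolvesOn.eq_zero_of_tendsto {V : ℝ → ℝ} {E : ℝ} {l r : ℝ} {f : ℝ → ℂ}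
    (hf : SolvesOn V E (Ioo l r) f) (hV : IntegrableOn V (Ioo l r)) {F : Filter ℝ} [F.NeBot]
    (hF : Ioo l r ∈ F) (hp : HasLimitData f F 0 0) {t : ℝ} (ht : t ∈ Ioo l r) :
    f t = 0 ∧ deriv f t = 0 := by
  obtain ⟨C, hC⟩ := hf.exists_energy_le hV
  rw [← energy_eq_zero]
  refine le_antisymm ?_ (energy_nonneg f t)
  have h : Tendsto (fun s => C * energy f s) F (𝓝 (C * (‖(0 : ℂ)‖ ^ 2 + ‖(0 : ℂ)‖ ^ 2))) :=
    ((hp.1.norm.pow 2).add (hp.2.norm.pow 2)).const_mul C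
  simp only [norm_zero, ne_eq, OfNat.ofNat_ne_zero, not_false_eq_true, zero_pow, add_zero,
    mul_zero] at h
  refine ge_of_tendsto h ?_
  filter_upwards [hF] with s hs using hC t ht s hs

theorem SolvesOn.hasLimitData_zero {V : ℝ → ℝ} {E : ℝ} {l r : ℝ} {f : ℝ → ℂ}
    (hf : SolvesOn V E (Ioo l r) f) (hV : IntegrableOn V (Ioo l r)) {F : Filter ℝ}
    (hF : Ioo l r ∈ F) {t : ℝ} (ht : t ∈ Ioo l r) (h0 : f t = 0 ∧ deriv f t = 0) :
    HasLimitData f F 0 0 := by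
  obtain ⟨C, hC⟩ := hf.exists_energy_le hV
  have h : ∀ s ∈ Ioo l r, f s = 0 ∧ deriv f s = 0 := fun s hs => by
    rw [← energy_eq_zero]
    have := hC s hs t ht
    rw [energy_eq_zero.2 h0, mul_zero] at this
    exact le_antisymm this (energy_nonneg f s)
  constructor
  · refine tendsto_const_nhds.congr' ?_
    filter_upwards [hF] with s hs using (h s hs).1.symm
  · refine tendsto_const_nhds.congr' ?_
    filter_upwards [hF] with s hs using (h s hs).2.symm

theorem HasLimitData.unique {f : ℝ → ℂ} {F : Filter ℝ} [F.NeBot] {p p' q q' : ℂ}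
    (hp : HasLimitData f F p p') (hq : HasLimitData f F q q') : p = q ∧ p' = q' :=
  ⟨tendsto_nhds_unique hp.1 hq.1, tendsto_nhds_unique hp.2 hq.2⟩

theorem HasLimitData.star {f : ℝ → ℂ} {F : Filter ℝ} {p p' : ℂ} (hp : HasLimitData f F p p') :
    HasLimitData (fun t => star (f t)) F (star p) (star p') :=
  ⟨hp.1.star, by rw [deriv.star']; exact hp.2.star⟩

/-! ### Interaction conditions -/

theorem jumpCondition_iff {A : Matrix (Fin 2) (Fin 2) ℝ} {y : ℝ} {f : ℝ → ℂ} :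
    JumpCondition A y f ↔ ∃ p p' : ℂ, HasLimitData f (𝓝[<] y) p p' ∧
      HasLimitData f (𝓝[>] y) (A 0 0 * p + A 0 1 * p') (A 1 0 * p + A 1 1 * p') := by
  have hvec : ∀ p p' : ℂ, (A.map Complex.ofReal).mulVec ![p, p'] =
      ![A 0 0 * p + A 0 1 * p', A 1 0 * p + A 1 1 * p'] := by
    intro p p'
    ext i
    fin_cases i <;> simp [Matrix.mulVec, dotProduct, Fin.sum_univ_two]
  constructor
  · rintro ⟨p, p', q, q', h1, h2, h3⟩
    rw [hvec] at h3
    have e1 := congrFun h3 0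
    have e2 := congrFun h3 1
    simp only [Matrix.cons_val_zero, Matrix.cons_val_one] at e1 e2
    subst e1 e2
    exact ⟨p, p', h1, h2⟩
  · rintro ⟨p, p', h1, h2⟩
    exact ⟨p, p', _, _, h1, h2, (hvec p p').symm⟩

theorem JumpCondition.star {A : Matrix (Fin 2) (Fin 2) ℝ} {y : ℝ} {f : ℝ → ℂ}
    (hf : JumpCondition A y f) : JumpCondition A y (fun t => star (f t)) := by
  obtain ⟨p, p', h1, h2⟩ := jumpCondition_iff.1 hf
  refine jumpCondition_iff.2 ⟨_, _, h1.star, ?_⟩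
  simpa using h2.star

theorem det_interactionMatrix (α θ : ℝ) {r : ℝ} (hr : r ≠ 0) :
    (interactionMatrix α r θ).det = 1 := by
  rw [interactionMatrix, Matrix.det_mul, Matrix.det_mul]
  simp only [Matrix.det_fin_two_of]
  have := Real.cos_sq_add_sin_sq θ
  field_simp
  linarith

/-! ### Solutions across interactions: Wronskian and unique continuation -/

variable {I : Set ℤ}

/-- An open interval in which the points `x n` do not accumulate and on which `V` is locally
integrable. -/
structure IsRegularRegion (x : I → ℝ) (V : ℝ → ℝ) (U : Set ℝ) : Prop where
  isOpen : IsOpen U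
  isPreconnected : IsPreconnected U
  eventually_notMem : ∀ y ∈ U, ∀ᶠ t in 𝓝[≠] y, t ∉ range x
  integrable : ∀ y ∈ U, IntegrableAtFilter V (𝓝 y)

/-- `f` solves `τ f = E f` on `U`, with interactions given by the matrices `A n` at `x n`. -/
structure PiecewiseSolvesOn (x : I → ℝ) (V : ℝ → ℝ) (E : ℝ)
    (A : I → Matrix (Fin 2) (Fin 2) ℝ) (U : Set ℝ) (f : ℝ → ℂ) : Prop where
  solvesOn : SolvesOn V E (U \ range x) f
  jump : ∀ n, x n ∈ U → JumpCondition (A n) (x n) f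

open Classical in
/-- The matrix `A n` if `y = x n`, and the identity at other points. -/
noncomputable def matrixAt (x : I → ℝ) (A : I → Matrix (Fin 2) (Fin 2) ℝ) (y : ℝ) :
    Matrix (Fin 2) (Fin 2) ℝ :=
  if h : ∃ n, x n = y then A h.choose else 1

theorem det_matrixAt {x : I → ℝ} {A : I → Matrix (Fin 2) (Fin 2) ℝ} (hA : ∀ n, (A n).det = 1)
    (y : ℝ) : (matrixAt x A y).det = 1 := by
  unfold matrixAt
  split_ifs
  · exact hA _
  · exact Matrix.det_one

variable {x : I → ℝ} {V : ℝ → ℝ} {E : ℝ} {A : I → Matrix (Fin 2) (Fin 2) ℝ} {U : Set ℝ}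
  {f g : ℝ → ℂ}

theorem IsRegularRegion.mono (hU : IsRegularRegion x V U) {W : Set ℝ} (hW : IsOpen W)
    (hW' : IsPreconnected W) (h : W ⊆ U) : IsRegularRegion x V W :=
  ⟨hW, hW', fun y hy => hU.eventually_notMem y (h hy), fun y hy => hU.integrable y (h hy)⟩

theorem IsRegularRegion.isOpen_diff (hU : IsRegularRegion x V U) : IsOpen (U \ range x) := by
  rw [isOpen_iff_mem_nhds]
  rintro y ⟨hy, hyx⟩
  have h := hU.eventually_notMem y hy
  rw [eventually_nhdsWithin_iff] at h
  filter_upwards [h, hU.isOpen.mem_nhds hy] with t ht htU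
  refine ⟨htU, ?_⟩
  by_cases hty : t = y
  · rwa [hty]
  · exact ht hty

theorem IsRegularRegion.exists_Ioo (hU : IsRegularRegion x V U) {y : ℝ} (hy : y ∈ U) :
    ∃ l r, l < y ∧ y < r ∧ Ioo l y ⊆ U \ range x ∧ Ioo y r ⊆ U \ range x ∧
      IntegrableOn V (Ioo l y) ∧ IntegrableOn V (Ioo y r) := by
  obtain ⟨s, hs, hVs⟩ := hU.integrable y hy
  have h := hU.eventually_notMem y hy
  rw [eventually_nhdsWithin_iff] at h
  obtain ⟨l, r, ⟨hl, hr⟩, hlr⟩ := mem_nhds_iff_exists_Ioo_subset.1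
    (inter_mem (inter_mem hs h) (hU.isOpen.mem_nhds hy))
  have h1 : Ioo l y ⊆ Ioo l r := Ioo_subset_Ioo_right hr.le
  have h2 : Ioo y r ⊆ Ioo l r := Ioo_subset_Ioo_left hl.le
  exact ⟨l, r, hl, hr, fun t ht => ⟨(hlr (h1 ht)).2, (hlr (h1 ht)).1.2 ht.2.ne⟩,
    fun t ht => ⟨(hlr (h2 ht)).2, (hlr (h2 ht)).1.2 ht.1.ne'⟩,
    hVs.mono_set fun t ht => (hlr (h1 ht)).1.1, hVs.mono_set fun t ht => (hlr (h2 ht)).1.1⟩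

theorem PiecewiseSolvesOn.mono (hf : PiecewiseSolvesOn x V E A U f) {W : Set ℝ} (h : W ⊆ U) :
    PiecewiseSolvesOn x V E A W f :=
  ⟨hf.solvesOn.mono (sdiff_subset_sdiff_left h), fun n hn => hf.jump n (h hn)⟩

theorem PiecewiseSolvesOn.star (hf : PiecewiseSolvesOn x V E A U f) :
    PiecewiseSolvesOn x V E A U (fun t => star (f t)) := by
  refine ⟨⟨hf.solvesOn.1.star, ?_⟩, fun n hn => (hf.jump n hn).star⟩
  filter_upwards [hf.solvesOn.2] with t ht
  rw [tau_star, ht]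
  simp

theorem PiecewiseSolvesOn.continuousAt (hU : IsRegularRegion x V U)
    (hf : PiecewiseSolvesOn x V E A U f) {t : ℝ} (ht : t ∈ U \ range x) :
    ContinuousAt f t ∧ ContinuousAt (deriv f) t := by
  have hnhds := hU.isOpen_diff.mem_nhds ht
  refine ⟨((hf.solvesOn.1.2.1 t ht).differentiableAt hnhds).continuousAt, ?_⟩
  obtain ⟨l, r, hlr, hmem, hsub⟩ := exists_Icc_mem_subset_of_mem_nhds hnhds
  have h := (hf.solvesOn.1.2.2 l r (hlr.1.trans hlr.2) hsub).continuousOn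
  rw [uIcc_of_le (hlr.1.trans hlr.2)] at h
  exact h.continuousAt hmem

/-- An ordinary point counts as an interaction with the identity matrix, so later arguments treat
all points of `U` alike. -/
theorem PiecewiseSolvesOn.jumpCondition (hU : IsRegularRegion x V U)
    (hf : PiecewiseSolvesOn x V E A U f) {y : ℝ} (hy : y ∈ U) :
    JumpCondition (matrixAt x A y) y f := by
  unfold matrixAt
  split_ifs with h
  · have hn : x h.choose = y := h.choose_spec
    rw [← hn] at hy
    have := hf.jump _ hy
    rwa [hn] at this
  · have hc := hf.continuousAt hU (t := y) ⟨hy, h⟩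
    refine jumpCondition_iff.2 ⟨f y, deriv f y, ⟨hc.1.mono_left nhdsWithin_le_nhds,
      hc.2.mono_left nhdsWithin_le_nhds⟩, ?_⟩
    constructor
    · simpa using hc.1.mono_left nhdsWithin_le_nhds
    · simpa using hc.2.mono_left nhdsWithin_le_nhds

/-- Having the same eventual value is an equivalence relation that holds locally, hence everywhere
on a preconnected set. Punctured neighbourhoods are used because `W` carries no information at the
interaction points. It is applied with complex values to the Wronskian and with `β = Prop` to the
vanishing of `(f, f')`. -/
theorem _root_.IsPreconnected.exists_forall_eventually_eq {X β : Type*} [TopologicalSpace X]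
    [T1Space X] {U : Set X} (hU : IsPreconnected U) [∀ y : X, (𝓝[≠] y).NeBot] [Nonempty β]
    {W : X → β} (h : ∀ y ∈ U, ∃ k, ∀ᶠ t in 𝓝[≠] y, W t = k) :
    ∃ k, ∀ y ∈ U, ∀ᶠ t in 𝓝[≠] y, W t = k := by
  rcases U.eq_empty_or_nonempty with rfl | ⟨y₀, hy₀⟩
  · exact ⟨Classical.arbitrary β, by simp⟩
  obtain ⟨k, hk⟩ := h y₀ hy₀
  refine ⟨k, fun y hy => ?_⟩
  refine hU.induction₂ (fun y z => ∀ k, (∀ᶠ t in 𝓝[≠] y, W t = k) ↔ ∀ᶠ t in 𝓝[≠] z, W t = k)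
    ?_ (fun _ _ _ _ _ _ h1 h2 k => (h1 k).trans (h2 k)) (fun _ _ _ _ h k => (h k).symm)
    hy₀ hy k |>.1 hk
  intro y hy
  obtain ⟨k, hk⟩ := h y hy
  have hk' : ∀ᶠ z in 𝓝 y, ∀ᶠ t in 𝓝[≠] z, W t = k := by
    have h1 := eventually_eventually_nhds.2 (eventually_nhdsWithin_iff.1 hk)
    filter_upwards [h1] with z hz
    by_cases hzy : z = y
    · rwa [hzy]
    · filter_upwards [hz.filter_mono nhdsWithin_le_nhds,
        mem_nhdsWithin_of_mem_nhds (isOpen_ne.mem_nhds hzy)] with t ht hty using ht hty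
  filter_upwards [hk'.filter_mono nhdsWithin_le_nhds] with z hz k'
  constructor
  · intro h
    obtain ⟨t, h1, h2⟩ := (hk.and h).exists
    rwa [← h2, h1]
  · intro h
    obtain ⟨t, h1, h2⟩ := (hz.and h).exists
    rwa [← h2, h1]

theorem wronskian_mulVec {B : Matrix (Fin 2) (Fin 2) ℝ} (hB : B.det = 1) (p p' q q' : ℂ) :
    (B 0 0 * p + B 0 1 * p') * (B 1 0 * q + B 1 1 * q') -
      (B 1 0 * p + B 1 1 * p') * (B 0 0 * q + B 0 1 * q') = p * q' - p' * q := by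
  have h : (B 0 0 : ℂ) * B 1 1 - B 0 1 * B 1 0 = 1 := by
    rw [Matrix.det_fin_two] at hB
    exact_mod_cast hB
  linear_combination (p * q' - p' * q) * h

/-- On each side of a point the Wronskian equals its one-sided limit, and a matrix of determinant
one makes the two limits agree. -/
theorem PiecewiseSolvesOn.exists_wronskian_eq (hU : IsRegularRegion x V U)
    (hA : ∀ n, (A n).det = 1)
    (hf : PiecewiseSolvesOn x V E A U f) (hg : PiecewiseSolvesOn x V E A U g) :
    ∃ k, ∀ t ∈ U \ range x, wronskian f g t = k := by
  obtain ⟨k, hk⟩ := hU.isPreconnected.exists_forall_eventually_eq (W := wronskian f g) (by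
    intro y hy
    obtain ⟨l, r, hl, hr, hL, hR, -, -⟩ := hU.exists_Ioo hy
    obtain ⟨p, p', hp, hp'⟩ := jumpCondition_iff.1 (hf.jumpCondition hU hy)
    obtain ⟨q, q', hq, hq'⟩ := jumpCondition_iff.1 (hg.jumpCondition hU hy)
    refine ⟨p * q' - p' * q, ?_⟩
    rw [← nhdsLT_sup_nhdsGT, eventually_sup]
    constructor
    · filter_upwards [Ioo_mem_nhdsLT hl] with t ht
      exact (hf.solvesOn.mono hL).wronskian_eq_of_tendsto (hg.solvesOn.mono hL)
        (Ioo_mem_nhdsLT hl) hp hq ht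
    · filter_upwards [Ioo_mem_nhdsGT hr] with t ht
      rw [(hf.solvesOn.mono hR).wronskian_eq_of_tendsto (hg.solvesOn.mono hR)
        (Ioo_mem_nhdsGT hr) hp' hq' ht]
      exact wronskian_mulVec (det_matrixAt hA y) p p' q q')
  -- Off the interaction points the Wronskian is continuous, so the punctured statement gives the
  -- value at `t` itself.
  refine ⟨k, fun t ht => ?_⟩
  have h1 : Tendsto (wronskian f g) (𝓝[≠] t) (𝓝 (wronskian f g t)) :=
    (((hf.continuousAt hU ht).1.mul (hg.continuousAt hU ht).2).sub
      ((hf.continuousAt hU ht).2.mul (hg.continuousAt hU ht).1)).mono_left nhdsWithin_le_nhds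
  exact tendsto_nhds_unique_of_eventuallyEq h1 tendsto_const_nhds (hk t ht.1)

/-- Unique continuation. -/
theorem PiecewiseSolvesOn.eq_zero (hU : IsRegularRegion x V U)
    (hA : ∀ n, (A n).det = 1) (hf : PiecewiseSolvesOn x V E A U f) {y₀ : ℝ} (hy₀ : y₀ ∈ U)
    (h0 : HasLimitData f (𝓝[<] y₀) 0 0) : ∀ t ∈ U \ range x, f t = 0 := by
  obtain ⟨k, hk⟩ := hU.isPreconnected.exists_forall_eventually_eq
    (W := fun t => f t = 0 ∧ deriv f t = 0) (by
    intro y hy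
    obtain ⟨l, r, hl, hr, hL, hR, hVL, hVR⟩ := hU.exists_Ioo hy
    obtain ⟨p, p', hp, hp'⟩ := jumpCondition_iff.1 (hf.jumpCondition hU hy)
    set B := matrixAt x A y
    have hB : (B 0 0 : ℂ) * B 1 1 - B 0 1 * B 1 0 = 1 := by
      have := det_matrixAt (x := x) hA y
      rw [Matrix.det_fin_two] at this
      exact_mod_cast this
    refine ⟨p = 0 ∧ p' = 0, ?_⟩
    rw [← nhdsLT_sup_nhdsGT, eventually_sup]
    constructor
    · filter_upwards [Ioo_mem_nhdsLT hl] with t ht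
      refine propext ⟨fun h => ?_, ?_⟩
      · exact hp.unique ((hf.solvesOn.mono hL).hasLimitData_zero hVL (Ioo_mem_nhdsLT hl) ht h)
      · rintro ⟨rfl, rfl⟩
        exact (hf.solvesOn.mono hL).eq_zero_of_tendsto hVL (Ioo_mem_nhdsLT hl) hp ht
    · filter_upwards [Ioo_mem_nhdsGT hr] with t ht
      refine propext ⟨fun h => ?_, ?_⟩
      · obtain ⟨h1, h2⟩ :=
          hp'.unique ((hf.solvesOn.mono hR).hasLimitData_zero hVR (Ioo_mem_nhdsGT hr) ht h)
        constructor
        -- The adjugate of `B` inverts the jump.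
        · linear_combination (-p) * hB + (B 1 1 : ℂ) * h1 - (B 0 1 : ℂ) * h2
        · linear_combination (-p') * hB + (B 0 0 : ℂ) * h2 - (B 1 0 : ℂ) * h1
      · rintro ⟨rfl, rfl⟩
        simp only [mul_zero, add_zero] at hp'
        exact (hf.solvesOn.mono hR).eq_zero_of_tendsto hVR (Ioo_mem_nhdsGT hr) hp' ht)
  have hk' : k := by
    obtain ⟨l, r, hl, hr, hL, hR, hVL, hVR⟩ := hU.exists_Ioo hy₀
    have hk1 := hk y₀ hy₀
    rw [← nhdsLT_sup_nhdsGT, eventually_sup] at hk1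
    obtain ⟨t, h1, h2⟩ := (hk1.1.and (Ioo_mem_nhdsLT hl)).exists
    rw [← h1]
    exact (hf.solvesOn.mono hL).eq_zero_of_tendsto hVL (Ioo_mem_nhdsLT hl) h0 h2
  intro t ht
  have h1 : Tendsto f (𝓝[≠] t) (𝓝 (f t)) :=
    (hf.continuousAt hU ht).1.mono_left nhdsWithin_le_nhds
  refine tendsto_nhds_unique_of_eventuallyEq h1 tendsto_const_nhds ?_
  filter_upwards [hk t ht.1] with s hs
  exact (hs.symm ▸ hk' : f s = 0 ∧ deriv f s = 0).1

theorem BoundaryCondition.star {ψ : ℝ} {F : Filter ℝ} (h : BoundaryCondition ψ F f) :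
    BoundaryCondition ψ F (fun t => star (f t)) := by
  obtain ⟨p, p', h1, h2⟩ := h
  refine ⟨_, _, h1.star, ?_⟩
  have := congrArg (starRingEnd ℂ) h2
  simpa [-Complex.ofReal_cos, -Complex.ofReal_sin] using this

/-- At an end of `U` that is limit point or carries a separated boundary condition, the
square integrable solutions satisfying the boundary condition are proportional. -/
theorem PiecewiseSolvesOn.wronskian_eq_zero (hU : IsRegularRegion x V U)
    (hA : ∀ n, (A n).det = 1)
    (hf : PiecewiseSolvesOn x V E A U f) (hg : PiecewiseSolvesOn x V E A U g)
    (hfL : MemLp f 2 (volume.restrict U)) (hgL : MemLp g 2 (volume.restrict U))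
    (hend : (∃ h, PiecewiseSolvesOn x V E A U h ∧ ¬ MemLp h 2 (volume.restrict U)) ∨
      ∃ F : Filter ℝ, F.NeBot ∧ (∀ᶠ t in F, t ∈ U \ range x) ∧
        ∃ ψ, BoundaryCondition ψ F f ∧ BoundaryCondition ψ F g) :
    ∀ t ∈ U \ range x, wronskian f g t = 0 := by
  obtain ⟨k, hk⟩ := hf.exists_wronskian_eq hU hA hg
  suffices k = 0 by rwa [this] at hk
  rcases hend with ⟨h, hh, hhL⟩ | ⟨F, hF, hFU, ψ, ⟨p, p', hp, hp0⟩, ⟨q, q', hq, hq0⟩⟩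
  · by_contra hk0
    obtain ⟨m, hm⟩ := hh.exists_wronskian_eq hU hA hg
    obtain ⟨n, hn⟩ := hf.exists_wronskian_eq hU hA hh
    -- If `k ≠ 0`, then `f` and `g` span all solutions: Cramer's rule gives `h = (W(h,g) f + W(f,h)
    -- g) / W(f,g)`, which would be square integrable.
    refine hhL (((hfL.const_mul (m / k)).add (hgL.const_mul (n / k))).ae_eq ?_)
    have hx : ∀ᵐ t ∂volume.restrict U, t ∉ range x :=
      ae_restrict_of_ae ((countable_range x).ae_notMem _)
    filter_upwards [ae_restrict_mem hU.isOpen.measurableSet, hx] with t ht htx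
    have e1 := hk t ⟨ht, htx⟩
    have e2 := hm t ⟨ht, htx⟩
    have e3 := hn t ⟨ht, htx⟩
    simp only [Pi.add_apply]
    field_simp
    rw [← e1, ← e2, ← e3]
    unfold wronskian
    ring
  · have h1 : Tendsto (wronskian f g) F (𝓝 (p * q' - p' * q)) :=
      (hp.1.mul hq.2).sub (hp.2.mul hq.1)
    have h2 : p * q' - p' * q = k :=
      tendsto_nhds_unique_of_eventuallyEq h1 tendsto_const_nhds
        (by filter_upwards [hFU] with t ht using hk t ht)
    -- Both data annihilate the nonzero vector `(cos ψ, sin ψ)`, so they are parallel.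
    have hcs : (Real.cos ψ : ℂ) ^ 2 + (Real.sin ψ : ℂ) ^ 2 = 1 := by
      exact_mod_cast Real.cos_sq_add_sin_sq ψ
    rw [← h2]
    linear_combination (-(p * q' - p' * q)) * hcs +
      (Real.cos ψ * q' - Real.sin ψ * q) * hp0 - (Real.cos ψ * p' - Real.sin ψ * p) * hq0

/-! ### Bound states on `(a, b)` -/

theorem isOpen_openInterval (a b : EReal) : IsOpen (openInterval a b) :=
  (isOpen_lt continuous_const continuous_coe_real_ereal).inter
    (isOpen_lt continuous_coe_real_ereal continuous_const)

theorem isPreconnected_openInterval (a b : EReal) : IsPreconnected (openInterval a b) := by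
  refine OrdConnected.isPreconnected ⟨fun c hc d hd t ht => ⟨?_, ?_⟩⟩
  · exact hc.1.trans_le (EReal.coe_le_coe_iff.2 ht.1)
  · exact (EReal.coe_le_coe_iff.2 ht.2).trans_lt hd.2

theorem openInterval_subset_left {a b : EReal} {y : ℝ} (hy : y ∈ openInterval a b) :
    openInterval a y ⊆ openInterval a b :=
  fun _ ht => ⟨ht.1, ht.2.trans hy.2⟩

theorem openInterval_subset_right {a b : EReal} {y : ℝ} (hy : y ∈ openInterval a b) :
    openInterval y b ⊆ openInterval a b :=
  fun _ ht => ⟨hy.1.trans ht.1, ht.2⟩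

variable {a b : EReal} {A' : I → Matrix (Fin 2) (Fin 2) ℝ}

theorem isRegularRegion_openInterval (hV : LocallyIntegrableOn V (openInterval a b))
    (hx : ∀ c ∈ openInterval a b, ∀ d ∈ openInterval a b, (range x ∩ Icc c d).Finite) :
    IsRegularRegion x V (openInterval a b) where
  isOpen := isOpen_openInterval a b
  isPreconnected := isPreconnected_openInterval a b
  integrable y hy := by
    have := hV y hy
    rwa [(isOpen_openInterval a b).nhdsWithin_eq hy] at this
  eventually_notMem y hy := by
    obtain ⟨c, d, hcd, hmem, hsub⟩ :=
      exists_Icc_mem_subset_of_mem_nhds ((isOpen_openInterval a b).mem_nhds hy)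
    have hle := hcd.1.trans hcd.2
    have hfin := (hx c (hsub (left_mem_Icc.2 hle)) d (hsub (right_mem_Icc.2 hle))).subset
      (sdiff_subset (t := {y}))
    have h1 : ((range x ∩ Icc c d) \ {y})ᶜ ∈ 𝓝 y :=
      hfin.isClosed.isOpen_compl.mem_nhds fun h => h.2 rfl
    rw [eventually_nhdsWithin_iff]
    filter_upwards [h1, hmem] with t ht htm hty htx
    exact ht ⟨⟨htx, htm⟩, hty⟩

theorem PiecewiseSolvesOn.congr (hf : PiecewiseSolvesOn x V E A U f)
    (h : ∀ n, x n ∈ U → A n = A' n) : PiecewiseSolvesOn x V E A' U f :=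
  ⟨hf.solvesOn, fun n hn => h n hn ▸ hf.jump n hn⟩

theorem IsSolution.piecewiseSolvesOn {Λ : I → ℝ} {R : I → Ioi (0 : ℝ)} {Θ : I → ℝ}
    (hf : IsSolution a b V x Λ R Θ E f) :
    PiecewiseSolvesOn x V E (fun n => interactionMatrix (Λ n) (R n) (Θ n))
      (openInterval a b) f := by
  refine ⟨⟨hf.1, ?_⟩, fun n _ => hf.2.2 n⟩
  filter_upwards [ae_restrict_of_ae_restrict_of_subset sdiff_subset hf.2.1] with t ht
  exact sub_eq_zero.1 ht

/-- A square integrable solution that satisfies the boundary conditions at regular endpoints. -/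
structure IsBoundSolution (a b : EReal) (V : ℝ → ℝ) (x : I → ℝ) (ψa ψb E : ℝ)
    (A : I → Matrix (Fin 2) (Fin 2) ℝ) (f : ℝ → ℂ) : Prop where
  solves : PiecewiseSolvesOn x V E A (openInterval a b) f
  memLp : MemLp f 2 (volume.restrict (openInterval a b))
  left : ∀ a₀ : ℝ, RegularLeft a b V x a₀ → BoundaryCondition ψa (𝓝[>] a₀) f
  right : ∀ b₀ : ℝ, RegularRight a b V x b₀ → BoundaryCondition ψb (𝓝[<] b₀) f

variable {ψa ψb : ℝ}

theorem IsBoundSolution.star (hf : IsBoundSolution a b V x ψa ψb E A f) :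
    IsBoundSolution a b V x ψa ψb E A (fun t => star (f t)) :=
  ⟨hf.solves.star, hf.memLp.star, fun a₀ h => (hf.left a₀ h).star,
    fun b₀ h => (hf.right b₀ h).star⟩

theorem IsEigenvalue.exists_isBoundSolution {Λ : I → ℝ} {R : I → Ioi (0 : ℝ)} {Θ : I → ℝ}
    (h : IsEigenvalue a b V x Λ R Θ ψa ψb E) :
    ∃ f, IsBoundSolution a b V x ψa ψb E
        (fun n => interactionMatrix (Λ n) (R n) (Θ n)) f ∧
      ¬ f =ᵐ[volume.restrict (openInterval a b)] 0 := by
  obtain ⟨f, ⟨⟨h1, h2, -, h3⟩, h4, h5⟩, h6, h7⟩ := h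
  exact ⟨f, ⟨⟨⟨h2, ae_restrict_of_ae_restrict_of_subset sdiff_subset h7⟩, fun n _ => h3 n⟩,
    h1, h4, h5⟩, h6⟩

/-- The matrices may differ at `y` and to its right; left of `y` both functions solve the same
equation, so only the end `a` matters. -/
theorem IsBoundSolution.wronskian_left (hU : IsRegularRegion x V (openInterval a b))
    (hA : ∀ n, (A n).det = 1) {y : ℝ} (hy : y ∈ openInterval a b)
    (hAA' : ∀ n, x n ∈ openInterval a y → A' n = A n)
    (hend : (∃ h, PiecewiseSolvesOn x V E A (openInterval a b) h ∧ ¬ LiesLeft a b h) ∨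
      ∃ a₀ : ℝ, RegularLeft a b V x a₀)
    (hf : IsBoundSolution a b V x ψa ψb E A f) (hg : IsBoundSolution a b V x ψa ψb E A' g) :
    ∀ t ∈ openInterval a y \ range x, wronskian f g t = 0 := by
  have hsub := openInterval_subset_left hy
  refine (hf.solves.mono hsub).wronskian_eq_zero
    (hU.mono (isOpen_openInterval _ _) (isPreconnected_openInterval _ _) hsub) hA
    ((hg.solves.mono hsub).congr hAA') (hf.memLp.mono_measure (Measure.restrict_mono_set _ hsub))
    (hg.memLp.mono_measure (Measure.restrict_mono_set _ hsub)) (hend.imp ?_ ?_)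
  · rintro ⟨h, h1, h2⟩
    exact ⟨h, h1.mono hsub, fun h3 => h2 ⟨y, hy, h3⟩⟩
  · rintro ⟨a₀, ha₀⟩
    refine ⟨𝓝[>] a₀, inferInstance, ?_, ψa, hf.left a₀ ha₀, hg.left a₀ ha₀⟩
    obtain ⟨rfl, -, c, hc, hcx⟩ := ha₀
    filter_upwards [Ioo_mem_nhdsGT hc, Ioo_mem_nhdsGT (EReal.coe_lt_coe_iff.1 hy.1)]
      with t ht ht'
    refine ⟨⟨EReal.coe_lt_coe_iff.2 ht.1, EReal.coe_lt_coe_iff.2 ht'.2⟩, ?_⟩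
    rintro ⟨n, rfl⟩
    exact absurd (hcx n) (not_le.2 ht.2)

theorem IsBoundSolution.wronskian_right (hU : IsRegularRegion x V (openInterval a b))
    (hA : ∀ n, (A n).det = 1) {y : ℝ} (hy : y ∈ openInterval a b)
    (hAA' : ∀ n, x n ∈ openInterval y b → A' n = A n)
    (hend : (∃ h, PiecewiseSolvesOn x V E A (openInterval a b) h ∧ ¬ LiesRight a b h) ∨
      ∃ b₀ : ℝ, RegularRight a b V x b₀)
    (hf : IsBoundSolution a b V x ψa ψb E A f) (hg : IsBoundSolution a b V x ψa ψb E A' g) :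
    ∀ t ∈ openInterval y b \ range x, wronskian f g t = 0 := by
  have hsub := openInterval_subset_right hy
  refine (hf.solves.mono hsub).wronskian_eq_zero
    (hU.mono (isOpen_openInterval _ _) (isPreconnected_openInterval _ _) hsub) hA
    ((hg.solves.mono hsub).congr hAA') (hf.memLp.mono_measure (Measure.restrict_mono_set _ hsub))
    (hg.memLp.mono_measure (Measure.restrict_mono_set _ hsub)) (hend.imp ?_ ?_)
  · rintro ⟨h, h1, h2⟩
    exact ⟨h, h1.mono hsub, fun h3 => h2 ⟨y, hy, h3⟩⟩
  · rintro ⟨b₀, hb₀⟩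
    refine ⟨𝓝[<] b₀, inferInstance, ?_, ψb, hf.right b₀ hb₀, hg.right b₀ hb₀⟩
    obtain ⟨rfl, -, c, hc, hcx⟩ := hb₀
    filter_upwards [Ioo_mem_nhdsLT hc, Ioo_mem_nhdsLT (EReal.coe_lt_coe_iff.1 hy.2)]
      with t ht ht'
    refine ⟨⟨EReal.coe_lt_coe_iff.2 ht'.1, EReal.coe_lt_coe_iff.2 ht.2⟩, ?_⟩
    rintro ⟨n, rfl⟩
    exact absurd (hcx n) (not_le.2 ht.1)

/-- For fixed data on both sides of an interaction, a bound state determines the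
elliptic angle modulo `π`. -/
theorem sin_sub_eq_zero_of_wronskian {α r θ θ' : ℝ} (hr : r ≠ 0) {p p' q q' : ℂ}
    (hp : ¬ (p = 0 ∧ p' = 0)) (hq : ¬ (q = 0 ∧ q' = 0))
    (h1 : p * q' - p' * q = 0) (h2 : p * star p' - p' * star p = 0)
    (h3 : (interactionMatrix α r θ 0 0 * p + interactionMatrix α r θ 0 1 * p') *
        (interactionMatrix α r θ' 1 0 * q + interactionMatrix α r θ' 1 1 * q') -
      (interactionMatrix α r θ 1 0 * p + interactionMatrix α r θ 1 1 * p') *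
        (interactionMatrix α r θ' 0 0 * q + interactionMatrix α r θ' 0 1 * q') = 0) :
    Real.sin (θ' - θ) = 0 := by
  have hrC : (r : ℂ) ≠ 0 := Complex.ofReal_ne_zero.2 hr
  -- The common factors have determinant one and drop out of `h3`. What remains is `cos (θ' - θ) (p
  -- q' - p' q) + sin (θ' - θ) (p q + p' q')`, whose first term vanishes by `h1`.
  have key : (Real.sin (θ' - θ) : ℂ) * (p * q + p' * q') = 0 := by
    rw [Real.sin_sub]
    simp only [interactionMatrix, Matrix.mul_apply, Fin.sum_univ_two, Matrix.of_apply,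
      Matrix.cons_val', Matrix.cons_val_zero, Matrix.cons_val_one, Matrix.cons_val_fin_one] at h3
    generalize Real.sin θ = s, Real.cos θ = c, Real.sin θ' = s', Real.cos θ' = c' at h3 ⊢
    push_cast at h3 ⊢
    have hr1 : (r : ℂ) * (1 / r) = 1 := mul_one_div_cancel hrC
    linear_combination h3 - ((c : ℂ) * c' + s * s') * h1 -
      ((c * p - s * p') * (s' * q + c' * q') - (s * p + c * p') * (c' * q - s' * q')) * hr1
  rcases mul_eq_zero.1 key with h | h
  · exact_mod_cast h
  -- Otherwise the data are isotropic for the bilinear form, `p² + p'² = 0`. A nonzero complex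
  -- vector can be isotropic, but not one proportional to its conjugate, which is what `h2`
  -- expresses.
  · exfalso
    have e1 : (p ^ 2 + p' ^ 2) * q = 0 := by linear_combination p * h - p' * h1
    have e2 : (p ^ 2 + p' ^ 2) * q' = 0 := by linear_combination p' * h + p * h1
    have e3 : p ^ 2 + p' ^ 2 = 0 := by
      by_contra hne
      exact hq ⟨(mul_eq_zero.1 e1).resolve_left hne, (mul_eq_zero.1 e2).resolve_left hne⟩
    have hnorm : p * star p + p' * star p' ≠ 0 := by
      rw [Complex.star_def, Complex.mul_conj, Complex.mul_conj]
      norm_cast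
      intro h0
      have := (add_eq_zero_iff_of_nonneg (Complex.normSq_nonneg p) (Complex.normSq_nonneg p')).1 h0
      exact hp ⟨Complex.normSq_eq_zero.1 this.1, Complex.normSq_eq_zero.1 this.2⟩
    refine hp ⟨(mul_eq_zero.1 (?_ : p * (p * star p + p' * star p') = 0)).resolve_right hnorm,
      (mul_eq_zero.1 (?_ : p' * (p * star p + p' * star p') = 0)).resolve_right hnorm⟩
    · linear_combination star p * e3 + p' * h2
    · linear_combination star p' * e3 - p * h2

/-- Three vanishing Wronskians feed the algebraic lemma: `f` with `g` on the left, `f` with its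
conjugate on the left, and `f` with `g` on the right. Unique continuation keeps the left data
nonzero. -/
theorem IsBoundSolution.sin_sub_eq_zero (hU : IsRegularRegion x V (openInterval a b))
    {n₀ : I} (hn₀ : x n₀ ∈ openInterval a b)
    {Λ : I → ℝ} {R : I → Ioi (0 : ℝ)} {Θ Θ' : I → ℝ} (hΘ : ∀ n, n ≠ n₀ → Θ' n = Θ n)
    (ha : LimitPointLeft a b V x Λ R Θ ∨ ∃ a₀ : ℝ, RegularLeft a b V x a₀)
    (hb : LimitPointRight a b V x Λ R Θ ∨ ∃ b₀ : ℝ, RegularRight a b V x b₀)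
    (hf : IsBoundSolution a b V x ψa ψb E (fun n => interactionMatrix (Λ n) (R n) (Θ n)) f)
    (hf0 : ¬ f =ᵐ[volume.restrict (openInterval a b)] 0)
    (hg : IsBoundSolution a b V x ψa ψb E (fun n => interactionMatrix (Λ n) (R n) (Θ' n)) g)
    (hg0 : ¬ g =ᵐ[volume.restrict (openInterval a b)] 0) :
    Real.sin (Θ' n₀ - Θ n₀) = 0 := by
  have hdet : ∀ (Θ : I → ℝ) (n : I), (interactionMatrix (Λ n) (R n) (Θ n)).det = 1 :=
    fun Θ n => det_interactionMatrix _ _ (ne_of_gt (R n).2)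
  have hne : ∀ {Θ : I → ℝ} {f : ℝ → ℂ} {p p' : ℂ},
      IsBoundSolution a b V x ψa ψb E (fun n => interactionMatrix (Λ n) (R n) (Θ n)) f →
      ¬ f =ᵐ[volume.restrict (openInterval a b)] 0 → HasLimitData f (𝓝[<] (x n₀)) p p' →
      ¬ (p = 0 ∧ p' = 0) := by
    rintro Θ f p p' hf hf0 hp ⟨rfl, rfl⟩
    refine hf0 ?_
    have hx : ∀ᵐ t ∂volume.restrict (openInterval a b), t ∉ range x :=
      ae_restrict_of_ae ((countable_range x).ae_notMem _)
    filter_upwards [ae_restrict_mem hU.isOpen.measurableSet, hx] with t ht htx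
    exact hf.solves.eq_zero hU (hdet Θ) hn₀ hp t ⟨ht, htx⟩
  obtain ⟨p, p', hp, hp'⟩ := jumpCondition_iff.1 (hf.solves.jump n₀ hn₀)
  obtain ⟨q, q', hq, hq'⟩ := jumpCondition_iff.1 (hg.solves.jump n₀ hn₀)
  have hendL : (∃ h, PiecewiseSolvesOn x V E (fun n => interactionMatrix (Λ n) (R n) (Θ n))
      (openInterval a b) h ∧ ¬ LiesLeft a b h) ∨ ∃ a₀ : ℝ, RegularLeft a b V x a₀ :=
    ha.imp (fun h => (h E).imp fun _ h => ⟨h.1.piecewiseSolvesOn, h.2⟩) id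
  have hendR : (∃ h, PiecewiseSolvesOn x V E (fun n => interactionMatrix (Λ n) (R n) (Θ n))
      (openInterval a b) h ∧ ¬ LiesRight a b h) ∨ ∃ b₀ : ℝ, RegularRight a b V x b₀ :=
    hb.imp (fun h => (h E).imp fun _ h => ⟨h.1.piecewiseSolvesOn, h.2⟩) id
  obtain ⟨l, r, hl, hr, hL, hR, -, -⟩ := hU.exists_Ioo hn₀
  have hmemL : ∀ᶠ t in 𝓝[<] (x n₀), t ∈ openInterval a (x n₀) \ range x := by
    filter_upwards [Ioo_mem_nhdsLT hl] with t ht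
    exact ⟨⟨(hL ht).1.1, EReal.coe_lt_coe_iff.2 ht.2⟩, (hL ht).2⟩
  have hmemR : ∀ᶠ t in 𝓝[>] (x n₀), t ∈ openInterval (x n₀) b \ range x := by
    filter_upwards [Ioo_mem_nhdsGT hr] with t ht
    exact ⟨⟨EReal.coe_lt_coe_iff.2 ht.1, (hR ht).1.2⟩, (hR ht).2⟩
  have hlim : ∀ {F : Filter ℝ} [F.NeBot] {S : Set ℝ} {u v : ℝ → ℂ} {p p' q q' : ℂ},
      (∀ᶠ t in F, t ∈ S) → (∀ t ∈ S, wronskian u v t = 0) → HasLimitData u F p p' →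
      HasLimitData v F q q' → p * q' - p' * q = 0 := by
    intro F _ S u v p p' q q' hS hW hu hv
    have h1 : Tendsto (wronskian u v) F (𝓝 (p * q' - p' * q)) :=
      (hu.1.mul hv.2).sub (hu.2.mul hv.1)
    exact tendsto_nhds_unique_of_eventuallyEq h1 tendsto_const_nhds
      (by filter_upwards [hS] with t ht using hW t ht)
  have hnL : ∀ n, x n ∈ openInterval a (x n₀) →
      interactionMatrix (Λ n) (R n) (Θ' n) = interactionMatrix (Λ n) (R n) (Θ n) := by
    intro n hn
    rw [hΘ n]
    rintro rfl
    exact lt_irrefl _ hn.2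
  have hnR : ∀ n, x n ∈ openInterval (x n₀) b →
      interactionMatrix (Λ n) (R n) (Θ' n) = interactionMatrix (Λ n) (R n) (Θ n) := by
    intro n hn
    rw [hΘ n]
    rintro rfl
    exact lt_irrefl _ hn.1
  exact sin_sub_eq_zero_of_wronskian (ne_of_gt (R n₀).2) (hne hf hf0 hp) (hne hg hg0 hq)
    (hlim hmemL (hf.wronskian_left hU (hdet Θ) hn₀ hnL hendL hg) hp hq)
    (hlim hmemL (hf.wronskian_left hU (hdet Θ) hn₀ (fun _ _ => rfl) hendL hf.star) hp hp.star)
    (hlim hmemR (hf.wronskian_right hU (hdet Θ) hn₀ hnR hendR hg) hp' hq')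

theorem _root_.Set.countable_of_forall_sin_sub_eq_zero {S : Set ℝ}
    (hS : ∀ s ∈ S, ∀ t ∈ S, Real.sin (t - s) = 0) : S.Countable := by
  rcases S.eq_empty_or_nonempty with rfl | ⟨s, hs⟩
  · exact countable_empty
  · refine (countable_range fun k : ℤ => s + k * Real.pi).mono fun t ht => ?_
    obtain ⟨k, hk⟩ := Real.sin_eq_zero_iff.1 (hS s hs t ht)
    exact ⟨k, by simp only; linarith⟩

/-! ### Resampling one coordinate -/

theorem _root_.measurable_update_prod {ι : Type*} [DecidableEq ι] {X : ι → Type*}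
    [∀ i, MeasurableSpace (X i)] (j : ι) :
    Measurable fun z : (∀ i, X i) × X j => Function.update z.1 j z.2 := by
  refine measurable_pi_lambda _ fun i => ?_
  by_cases h : i = j
  · subst h
    simpa using measurable_snd
  · simpa [h, Function.comp_def] using (measurable_pi_apply i).comp measurable_fst

/-- Replacing a coordinate by an independent copy preserves the product law. On a finite box, the
fresh sample supplies the factor at `j` if `j` is constrained; otherwise nothing changes. -/
theorem _root_.MeasureTheory.Measure.infinitePi_prod_map_update {ι : Type*} [DecidableEq ι]
    {X : ι → Type*} [∀ i, MeasurableSpace (X i)] (μ : ∀ i, Measure (X i))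
    [∀ i, IsProbabilityMeasure (μ i)] (j : ι) :
    ((Measure.infinitePi μ).prod (μ j)).map (fun z => Function.update z.1 j z.2) =
      Measure.infinitePi μ := by
  have hmeas := measurable_update_prod (X := X) j
  refine Measure.eq_infinitePi _ fun s t ht => ?_
  rw [Measure.map_apply hmeas (MeasurableSet.pi s.countable_toSet fun i _ => ht i)]
  by_cases hj : j ∈ s
  · have : (fun z : (∀ i, X i) × X j => Function.update z.1 j z.2) ⁻¹' (Set.pi s t) =
        (Set.pi (s.erase j : Finset ι) t) ×ˢ t j := by
      ext z
      simp only [mem_preimage, Set.mem_pi, mem_prod, Finset.mem_coe, Finset.mem_erase]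
      constructor
      · intro h
        exact ⟨fun i hi => by simpa [hi.1] using h i hi.2, by simpa using h j hj⟩
      · rintro ⟨h1, h2⟩ i hi
        by_cases hij : i = j
        · subst hij; simpa using h2
        · simpa [hij] using h1 i ⟨hij, hi⟩
    rw [this, Measure.prod_prod, Measure.infinitePi_pi _ fun i _ => ht i,
      Finset.prod_erase_mul _ _ hj]
  · have : (fun z : (∀ i, X i) × X j => Function.update z.1 j z.2) ⁻¹' (Set.pi s t) =
        (Set.pi s t) ×ˢ univ := by
      ext z
      simp only [mem_preimage, Set.mem_pi, mem_prod, mem_univ, and_true]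
      refine forall₂_congr fun i hi => ?_
      have hij : i ≠ j := fun h => hj (h ▸ hi)
      simp [hij]
    rw [this, Measure.prod_prod, Measure.infinitePi_pi _ fun i _ => ht i, measure_univ, mul_one]

/-- A measurable set in an infinite product is null if its sections in one coordinate are. -/
theorem _root_.MeasureTheory.Measure.infinitePi_eq_zero_of_update {ι : Type*} [DecidableEq ι]
    {X : ι → Type*} [∀ i, MeasurableSpace (X i)] (μ : ∀ i, Measure (X i))
    [∀ i, IsProbabilityMeasure (μ i)] (j : ι) {S : Set (∀ i, X i)} (hS : MeasurableSet S)
    (h : ∀ z, μ j {t | Function.update z j t ∈ S} = 0) : Measure.infinitePi μ S = 0 := by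
  have hmeas := measurable_update_prod (X := X) j
  rw [← Measure.infinitePi_prod_map_update μ j, Measure.map_apply hmeas hS,
    Measure.measure_prod_null (hmeas hS)]
  exact Eventually.of_forall h

end PointInteraction

theorem mainTheorem5
    (a b : EReal) (hab : a < b)
    (V : ℝ → ℝ) (hV : LocallyIntegrableOn V (PointInteraction.openInterval a b))
    (I : Set ℤ) (x : I → ℝ) (hx_inj : Function.Injective x)
    (hx_mem : ∀ n, x n ∈ PointInteraction.openInterval a b)
    (hx_acc : ∀ c ∈ PointInteraction.openInterval a b, ∀ d ∈ PointInteraction.openInterval a b,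
      (range x ∩ Icc c d).Finite)
    (ψa ψb : ℝ) (hψa : ψa ∈ Ico 0 Real.pi) (hψb : ψb ∈ Ico 0 Real.pi)
    (ha : ∀ (Λ : I → ℝ) (R : I → Ioi (0 : ℝ)) (Θ : I → ℝ),
      PointInteraction.LimitPointLeft a b V x Λ R Θ ∨
        ∃ a₀ : ℝ, PointInteraction.RegularLeft a b V x a₀)
    (hb : ∀ (Λ : I → ℝ) (R : I → Ioi (0 : ℝ)) (Θ : I → ℝ),
      PointInteraction.LimitPointRight a b V x Λ R Θ ∨
        ∃ b₀ : ℝ, PointInteraction.RegularRight a b V x b₀)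
    (p : I → Measure ℝ) [∀ n, IsProbabilityMeasure (p n)]
    (ρ : I → Measure (Ioi (0 : ℝ))) [∀ n, IsProbabilityMeasure (ρ n)]
    (q : I → Measure ℝ) [∀ n, IsProbabilityMeasure (q n)]
    (n₀ : I) (hq : ∀ t : ℝ, q n₀ {t} = 0)
    (E : ℝ)
    (hE : NullMeasurableSet (PointInteraction.eigenvalueSet a b V x ψa ψb E)
      (PointInteraction.parameterLaw p ρ q)) :
    PointInteraction.parameterLaw p ρ q
      (PointInteraction.eigenvalueSet a b V x ψa ψb E) = 0 := by
  have hU := PointInteraction.isRegularRegion_openInterval hV hx_acc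
  have : NullSingletonClass (q n₀) := ⟨hq⟩
  -- Fubini needs a measurable set. An inner approximation is chosen so that each of its points
  -- still provides an eigenfunction.
  obtain ⟨T, hTE, hT, hTae⟩ := hE.exists_measurable_subset_ae_eq
  rw [← measure_congr hTae, PointInteraction.parameterLaw, Measure.measure_prod_null hT]
  refine Eventually.of_forall fun Λ => ?_
  have hTΛ : MeasurableSet (Prod.mk Λ ⁻¹' T) := measurable_prodMk_left hT
  simp only [Pi.zero_apply]
  rw [Measure.measure_prod_null hTΛ]
  refine Eventually.of_forall fun R => ?_
  refine Measure.infinitePi_eq_zero_of_update q n₀ (measurable_prodMk_left hTΛ) fun Θ => ?_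
  -- Any two angles in the section differ by a multiple of `π`, and countable sets are null for the
  -- continuous measure `q n₀`.
  refine Set.Countable.measure_zero (Set.countable_of_forall_sin_sub_eq_zero ?_) _
  intro s hs t ht
  obtain ⟨f, hf, hf0⟩ := PointInteraction.IsEigenvalue.exists_isBoundSolution (hTE hs)
  obtain ⟨g, hg, hg0⟩ := PointInteraction.IsEigenvalue.exists_isBoundSolution (hTE ht)
  have := hf.sin_sub_eq_zero hU (hx_mem n₀)
    (fun n hn => by simp [Function.update_of_ne hn]) (ha _ _ _) (hb _ _ _) hf0 hg hg0
  simpa using this
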